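/- Let $T$ be the space of all unbounded sets $X\subseteq\mathbb N$, with the topology whose basic open sets are $\langle P,N\rangle=\{X\in T : P\subseteq X \text{ and } N\cap X \text{ is finite}\}$ for $P\subseteq\mathbb N$ finite and $N\subseteq\mathbb N$ arbitrary. The full topological model over $T$ consists of all terms, where a term is (hereditarily) a set of pairs $\langle\sigma,r\rangle$ with $\sigma$ a term and $r$ an open subset of $T$. Each formula $\varphi$ of set theory with terms as parameters has a truth value $[\![\varphi]\!]$ in the complete Heyting algebra $\mathcal O(T)$ of open sets, determined by $$[\![\sigma\in\tau]\!]=\bigvee_{\langle\tau',s\rangle\in\tau}\bigl(s\wedge[\![\sigma=\tau']\!]\bigr),\qquad [\![\sigma=\tau]\!]=\bigwedge_{\langle\sigma',r\rangle\in\sigma}\bigl(r\to[\![\sigma'\in\tau]\!]\bigr)\wedge\bigwedge_{\langle\tau',s\rangle\in\tau}\bigl(s\to[\![\tau'\in\sigma]\!]\bigr),$$ with connectives and quantifiers (ranging over all terms) interpreted by the Heyting algebra operations. An open set $O$ forces $\varphi$, written $O\Vdash\varphi$, if $O\subseteq[\![\varphi]\!]$. A ground model set $x$ has the canonical name $\hat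 x=\{\langle\hat y,T\rangle : y\in x\}$; the natural numbers of the model are $\hat\omega$, and $\hat n$ is written $n$. Let $G$ be the canonical generic, i.e. the term $\{\langle\hat n,\{X\in T: n\in X\}\rangle : n\in\mathbb N\}$. In the model, a set $A\subseteq\hat\omega$ is *bounded* if $\exists N\in\hat\omega\ \forall i\in A\ \, i\le N$, it is *unbounded* if $\forall N\in\hat\omega\ \exists i\in A\ \, i>N$, and it is *sequentially bounded* if every sequence of members of $A$ (every function $a:\hat\omega\to A$) is bounded, i.e. $\exists N\in\hat\omega\ \forall n\in\hat\omega\ \, a_n\le N$. **Theorem.** 1. For every nonempty basic open set $O=\langle P,N\rangle$ and every $n\in\mathbb N$, $O\Vdash n\in G$ if and only if $n\in P$; moreover $T\Vdash G\subseteq\hat\omega$. 2. $T\Vdash G$ is unbounded and sequentially bounded. 3. Consequently the weakening of BD to sequentially bounded sets is refuted: $T\Vdash\neg\,\forall A\subseteq\hat\omega\ (A\text{ sequentially bounded}\to A\text{ bounded})$. -/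

import Mathlib

open TopologicalSpace

universe u v w

/-! ### The full topological model over a space -/

/-- Terms (names) of the full topological model over `T`: a term is a family
`{⟨σ i, r i⟩ | i ∈ I}` of pairs consisting of a term and an open subset of `T`,
hereditarily, where `I` is an arbitrary index set. -/
inductive TopName (T : Type v) [TopologicalSpace T] : Type (max (u + 1) v)
  | mk (I : Type u) (σ : I → TopName T) (r : I → Opens T) : TopName T

namespace TopName

variable {T : Type v} [TopologicalSpace T]

/-- The truth value of `σ = τ`: every member of `σ` is, to the extent to which it is a member,
equal to a member of `τ`, and conversely. -/
def eqVal : TopName.{u} T → TopName.{u} T → Opens T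
  | mk I σ r, mk J τ s =>
    (⨅ i : I, r i ⇨ ⨆ j : J, s j ⊓ eqVal (σ i) (τ j)) ⊓
      (⨅ j : J, s j ⇨ ⨆ i : I, r i ⊓ eqVal (σ i) (τ j))

/-- The truth value of `σ ∈ τ`. -/
def memVal (σ : TopName.{u} T) : TopName.{u} T → Opens T
  | mk J τ s => ⨆ j : J, s j ⊓ eqVal σ (τ j)

/-- The canonical name `x̂ = {⟨ŷ, T⟩ | y ∈ x}` of a ground model set `x`. -/
def hat : PSet.{u} → TopName.{u} T
  | PSet.mk I A => mk I (fun i => hat (A i)) (fun _ => ⊤)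

end TopName

/-! ### Formulas of set theory and their truth values -/

/-- First-order formulas of set theory with parameters from `M`; the bound variable of a
quantifier is represented by a function on `M`. -/
inductive SetFormula (M : Type w) : Type w
  | mem (x y : M) : SetFormula M
  | eq (x y : M) : SetFormula M
  | bot : SetFormula M
  | and (φ ψ : SetFormula M) : SetFormula M
  | or (φ ψ : SetFormula M) : SetFormula M
  | imp (φ ψ : SetFormula M) : SetFormula M
  | all (φ : M → SetFormula M) : SetFormula M
  | ex (φ : M → SetFormula M) : SetFormula M

/-- The truth value of a formula in the full topological model over `T`. -/
def SetFormula.value {T : Type v} [TopologicalSpace T] :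
    SetFormula (TopName.{u} T) → Opens T
  | mem σ τ => TopName.memVal σ τ
  | eq σ τ => TopName.eqVal σ τ
  | bot => ⊥
  | and φ ψ => φ.value ⊓ ψ.value
  | or φ ψ => φ.value ⊔ ψ.value
  | imp φ ψ => φ.value ⇨ ψ.value
  | all φ => ⨅ σ, (φ σ).value
  | ex φ => ⨆ σ, (φ σ).value

/-- `Forces p φ`: the open set `p` forces `φ` in the full topological model. -/
def Forces {T : Type v} [TopologicalSpace T] (p : Opens T)
    (φ : SetFormula (TopName.{u} T)) : Prop :=
  p ≤ φ.value

namespace SetFormula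

variable {M : Type w}

def neg (φ : SetFormula M) : SetFormula M := imp φ bot

def iff (φ ψ : SetFormula M) : SetFormula M := and (imp φ ψ) (imp ψ φ)

/-- `∀ x ∈ A, φ x` -/
def ballIn (A : M) (φ : M → SetFormula M) : SetFormula M := all fun x => imp (mem x A) (φ x)

/-- `∃ x ∈ A, φ x` -/
def bexIn (A : M) (φ : M → SetFormula M) : SetFormula M := ex fun x => and (mem x A) (φ x)

/-- `A ⊆ B` -/
def sub (A B : M) : SetFormula M := ballIn A fun x => mem x B

/-- `z = {x, y}` -/
def isPair (z x y : M) : SetFormula M := all fun w => iff (mem w z) (or (eq w x) (eq w y))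

/-- `z = ⟨x, y⟩ = {{x}, {x, y}}` -/
def isOrdPair (z x y : M) : SetFormula M :=
  ex fun s => ex fun t => and (isPair s x x) (and (isPair t x y) (isPair z s t))

/-- `⟨x, y⟩ ∈ f` -/
def pairMem (f x y : M) : SetFormula M := bexIn f fun z => isOrdPair z x y

/-- `f` is a function from `A` to `B`. -/
def isFun (f A B : M) : SetFormula M :=
  and (ballIn f fun z => bexIn A fun x => bexIn B fun y => isOrdPair z x y)
    (ballIn A fun x => bexIn B fun y =>
      and (pairMem f x y) (all fun y' => imp (pairMem f x y') (eq y' y)))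

/-- `i < n` for von Neumann natural numbers -/
def lt (i n : M) : SetFormula M := mem i n

/-- `i ≤ n` for von Neumann natural numbers -/
def le (i n : M) : SetFormula M := or (mem i n) (eq i n)

/-! In the following formulas the parameter `ω` is the set of natural numbers. -/

/-- The set `A` of natural numbers is bounded. -/
def bounded (ω A : M) : SetFormula M := bexIn ω fun N => ballIn A fun i => le i N

/-- The set `A` of natural numbers is unbounded: `∀ N ∃ i ∈ A, i > N`. -/
def unbounded (ω A : M) : SetFormula M := ballIn ω fun N => bexIn A fun i => lt N i

/-- The sequence `a` of natural numbers is bounded. -/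
def seqIsBounded (ω a : M) : SetFormula M :=
  bexIn ω fun N => ballIn ω fun n => all fun y => imp (pairMem a n y) (le y N)

/-- `A` is sequentially bounded: every sequence of members of `A` is bounded. -/
def sequentiallyBounded (ω A : M) : SetFormula M :=
  all fun a => imp (isFun a ω A) (seqIsBounded ω a)

/-- Every sequentially bounded set of natural numbers is bounded. -/
def weakBD (ω : M) : SetFormula M :=
  all fun A => imp (and (sub A ω) (sequentiallyBounded ω A)) (bounded ω A)

end SetFormula

/-! ### The space of unbounded sets of natural numbers and its generic -/

/-- The unbounded sets of natural numbers. -/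
def UnbddSet : Type := {X : Set ℕ // ¬ BddAbove X}

namespace UnbddSet

/-- The set of all unbounded `X` with `P ⊆ X` and `N ∩ X` finite. -/
def basicSet (P : Finset ℕ) (N : Set ℕ) : Set UnbddSet :=
  {X | (P : Set ℕ) ⊆ X.1 ∧ (N ∩ X.1).Finite}

instance : TopologicalSpace UnbddSet :=
  generateFrom {U | ∃ (P : Finset ℕ) (N : Set ℕ), U = basicSet P N}

theorem basicSet_inter (P Q : Finset ℕ) (N K : Set ℕ) :
    basicSet P N ∩ basicSet Q K = basicSet (P ∪ Q) (N ∪ K) := by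
  ext X
  simp only [basicSet, Set.mem_inter_iff, Set.mem_ofPred_eq, Finset.coe_union,
    Set.union_subset_iff, Set.union_inter_distrib_right, Set.finite_union]
  tauto

theorem isTopologicalBasis_basicSet :
    IsTopologicalBasis {U : Set UnbddSet | ∃ (P : Finset ℕ) (N : Set ℕ), U = basicSet P N} where
  exists_subset_inter := by
    rintro _ ⟨P, N, rfl⟩ _ ⟨Q, K, rfl⟩ X hX
    exact ⟨_, ⟨P ∪ Q, N ∪ K, rfl⟩, basicSet_inter P Q N K ▸ hX,
      (basicSet_inter P Q N K).symm.subset⟩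
  sUnion_eq := by
    refine Set.eq_univ_of_forall fun X => ⟨basicSet ∅ ∅, ⟨∅, ∅, rfl⟩, ?_⟩
    simp [basicSet]
  eq_generateFrom := rfl

/-- The basic open set given by the positive information `P` and the negative information `N`. -/
def basicOpen (P : Finset ℕ) (N : Set ℕ) : Opens UnbddSet :=
  ⟨basicSet P N, isTopologicalBasis_basicSet.isOpen ⟨P, N, rfl⟩⟩

/-- The canonical name of the natural number `n` (a von Neumann numeral). -/
def natName (n : ℕ) : TopName.{u} UnbddSet := TopName.hat (PSet.ofNat n)

/-- The set of natural numbers of the model: the canonical image of the ground model's `ω`. -/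
def omegaName : TopName.{u} UnbddSet := TopName.hat PSet.omega

/-- The canonical generic: the name `{⟨n̂, {X | n ∈ X}⟩ | n ∈ ℕ}`. -/
def genericName : TopName.{u} UnbddSet :=
  TopName.mk (ULift.{u} ℕ) (fun n => natName n.down) (fun n => basicOpen {n.down} ∅)

end UnbddSet

/-!
Every basic open set `⟨P, N⟩` is connected: if `X` and `Y` belong to it, then so does `X ∪ Y`, and
`X ∪ Y` lies in the closure of every open set that contains `X` or `Y`. Distinct canonical names
are unequal at every point of the space, so a basic open set which forces `a : ω → G` splits, for
each `n`, into disjoint open sets according to the value `a n`. By connectedness it decides that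
value, and the value belongs to `P`, because `⟨P, N⟩` puts no other number into `G`. Hence
`max P` bounds the sequence `a`, whereas no natural number bounds `G`.
-/

theorem opens_le_himp_iff {T : Type v} [TopologicalSpace T] {p U V : Opens T} :
    p ≤ U ⇨ V ↔ ∀ x ∈ p, x ∈ U → x ∈ V := by
  rw [le_himp_iff]
  simp only [SetLike.le_def, Opens.mem_inf, and_imp]

theorem pset_mem_ofNat_iff {a : PSet.{u}} {n : ℕ} :
    a ∈ PSet.ofNat n ↔ ∃ m < n, PSet.Equiv a (PSet.ofNat.{u} m) := by
  induction n with
  | zero => simp only [PSet.ofNat, PSet.notMem_empty, not_lt_zero, false_and, exists_false]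
  | succ n ih => rw [PSet.ofNat, PSet.mem_insert_iff, ih, Nat.exists_lt_succ_right, or_comm]

theorem pset_ofNat_mem_ofNat_of_lt {m n : ℕ} (h : m < n) :
    PSet.ofNat.{u} m ∈ PSet.ofNat n :=
  pset_mem_ofNat_iff.2 ⟨m, h, .rfl⟩

theorem pset_ofNat_equiv_ofNat_iff {m n : ℕ} :
    PSet.Equiv (PSet.ofNat.{u} m) (PSet.ofNat.{u} n) ↔ m = n := by
  refine ⟨fun h => ?_, fun h => h ▸ .rfl⟩
  rcases lt_trichotomy m n with hlt | heq | hgt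
  · exact absurd ((PSet.Mem.congr_right h).2 (pset_ofNat_mem_ofNat_of_lt hlt)) (PSet.mem_irrefl _)
  · exact heq
  · exact absurd ((PSet.Mem.congr_right h).1 (pset_ofNat_mem_ofNat_of_lt hgt)) (PSet.mem_irrefl _)

theorem pset_ofNat_mem_ofNat_iff {m n : ℕ} : PSet.ofNat.{u} m ∈ PSet.ofNat n ↔ m < n := by
  simp only [pset_mem_ofNat_iff, pset_ofNat_equiv_ofNat_iff, exists_eq_right']

namespace TopName

variable {T : Type v} [TopologicalSpace T] {p : Opens T} {x : T} {I J : Type u}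
  {σ τ ρ : TopName.{u} T} {σs : I → TopName.{u} T} {r : I → Opens T} {τs : J → TopName.{u} T}
  {s : J → Opens T} {a b : PSet.{u}}

theorem mem_memVal_mk : x ∈ memVal σ (mk J τs s) ↔ ∃ j, x ∈ s j ∧ x ∈ eqVal σ (τs j) := by
  simp only [memVal, Opens.mem_iSup, Opens.mem_inf]

theorem le_eqVal_mk :
    p ≤ eqVal (mk I σs r) (mk J τs s) ↔
      (∀ i, ∀ x ∈ p, x ∈ r i → ∃ j, x ∈ s j ∧ x ∈ eqVal (σs i) (τs j)) ∧
        (∀ j, ∀ x ∈ p, x ∈ s j → ∃ i, x ∈ r i ∧ x ∈ eqVal (σs i) (τs j)) := by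
  simp only [eqVal, le_inf_iff, le_iInf_iff, opens_le_himp_iff, Opens.mem_iSup, Opens.mem_inf]

theorem exists_of_mem_eqVal_mk (h : x ∈ eqVal (mk I σs r) (mk J τs s)) {i : I} (hi : x ∈ r i) :
    ∃ j, x ∈ s j ∧ x ∈ eqVal (σs i) (τs j) :=
  (le_eqVal_mk.1 le_rfl).1 i x h hi

theorem mem_eqVal_refl (σ : TopName.{u} T) (x : T) : x ∈ eqVal σ σ := by
  induction σ generalizing x with
  | mk I σs r ih =>
    have h : ⊤ ≤ eqVal (mk I σs r) (mk I σs r) :=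
      le_eqVal_mk.2 ⟨fun i y _ hy => ⟨i, hy, ih i y⟩, fun i y _ hy => ⟨i, hy, ih i y⟩⟩
    exact h (Opens.mem_top x)

theorem eqVal_comm (σ τ : TopName.{u} T) : eqVal σ τ = eqVal τ σ := by
  induction σ generalizing τ with
  | mk I σs r ih =>
    obtain ⟨J, τs, s⟩ := τ
    simp only [eqVal, ih]
    exact inf_comm _ _

theorem mem_eqVal_symm (h : x ∈ eqVal σ τ) : x ∈ eqVal τ σ :=
  eqVal_comm σ τ ▸ h

theorem mem_eqVal_trans (hστ : x ∈ eqVal σ τ) (hτρ : x ∈ eqVal τ ρ) : x ∈ eqVal σ ρ := by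
  induction σ generalizing τ ρ x with
  | mk I σs r ih =>
    obtain ⟨J, τs, s⟩ := τ
    obtain ⟨K, ρs, t⟩ := ρ
    have h : eqVal (mk I σs r) (mk J τs s) ⊓ eqVal (mk J τs s) (mk K ρs t) ≤
        eqVal (mk I σs r) (mk K ρs t) := by
      refine le_eqVal_mk.2 ⟨fun i y hy hi => ?_, fun k y hy hk => ?_⟩
      · obtain ⟨j, hj, hij⟩ := exists_of_mem_eqVal_mk hy.1 hi
        obtain ⟨k, hk, hjk⟩ := exists_of_mem_eqVal_mk hy.2 hj
        exact ⟨k, hk, ih i hij hjk⟩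
      · obtain ⟨j, hj, hkj⟩ := exists_of_mem_eqVal_mk (mem_eqVal_symm hy.2) hk
        obtain ⟨i, hi, hji⟩ := exists_of_mem_eqVal_mk (mem_eqVal_symm hy.1) hj
        exact ⟨i, hi, ih i (mem_eqVal_symm hji) (mem_eqVal_symm hkj)⟩
    exact h ⟨hστ, hτρ⟩

theorem mem_eqVal_hat_hat : x ∈ eqVal (hat a) (hat b) ↔ PSet.Equiv a b := by
  induction a generalizing b x with
  | mk I A ih =>
    obtain ⟨J, B⟩ := b
    constructor
    · refine fun h => ⟨fun i => ?_, fun j => ?_⟩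
      · obtain ⟨j, -, hij⟩ := exists_of_mem_eqVal_mk h (Opens.mem_top x)
        exact ⟨j, (ih i).1 hij⟩
      · obtain ⟨i, -, hji⟩ := exists_of_mem_eqVal_mk (mem_eqVal_symm h) (Opens.mem_top x)
        exact ⟨i, (ih i).1 (mem_eqVal_symm hji)⟩
    · rintro ⟨hAB, hBA⟩
      have h : ⊤ ≤ eqVal (T := T) (hat ⟨I, A⟩) (hat ⟨J, B⟩) :=
        le_eqVal_mk.2 ⟨fun i y hy _ => (hAB i).imp fun j hij => ⟨hy, (ih i).2 hij⟩,
          fun j y hy _ => (hBA j).imp fun i hij => ⟨hy, (ih i).2 hij⟩⟩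
      exact h (Opens.mem_top x)

theorem mem_memVal_hat_hat : x ∈ memVal (hat a) (hat b) ↔ a ∈ b := by
  obtain ⟨J, B⟩ := b
  simp only [hat, mem_memVal_mk, Opens.mem_top, true_and, mem_eqVal_hat_hat, PSet.mem_def]
  rfl

end TopName

namespace SetFormula

/-- `y` is the unique value of `f` at `x`: the last clause in the definition of `isFun`. -/
def isValue {M : Type w} (f x y : M) : SetFormula M :=
  and (pairMem f x y) (all fun y' => imp (pairMem f x y') (eq y' y))

open TopName

variable {T : Type v} [TopologicalSpace T] {p : Opens T} {x : T}
  {φ ψ : SetFormula (TopName.{u} T)} {Φ Ψ : TopName.{u} T → SetFormula (TopName.{u} T)}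
  {σ τ A f : TopName.{u} T} {I : Type u} {σs : I → TopName.{u} T} {r : I → Opens T}

theorem forces_imp : Forces p (imp φ ψ) ↔ ∀ x ∈ p, x ∈ φ.value → x ∈ ψ.value :=
  opens_le_himp_iff

theorem forces_all : Forces p (all Φ) ↔ ∀ σ, Forces p (Φ σ) :=
  le_iInf_iff

theorem forces_ballIn : Forces p (ballIn A Φ) ↔ ∀ σ, ∀ x ∈ p, x ∈ memVal σ A → x ∈ (Φ σ).value :=
  forces_all.trans (forall_congr' fun _ => forces_imp)

theorem mem_value_imp (h : x ∈ (imp φ ψ).value) (hφ : x ∈ φ.value) : x ∈ ψ.value :=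
  forces_imp.1 le_rfl x h hφ

theorem mem_value_all (h : x ∈ (all Φ).value) (σ : TopName.{u} T) : x ∈ (Φ σ).value :=
  forces_all.1 le_rfl σ h

theorem mem_value_ballIn (h : x ∈ (ballIn A Φ).value) (hσ : x ∈ memVal σ A) : x ∈ (Φ σ).value :=
  forces_ballIn.1 le_rfl σ x h hσ

theorem mem_value_ex : x ∈ (ex Φ).value ↔ ∃ σ, x ∈ (Φ σ).value := by
  simp only [value, Opens.mem_iSup]

/-- The formula `Φ σ` respects equality of names in its parameter `σ`, so that a quantifier bounded
by a term `{⟨σ i, r i⟩ | i ∈ I}` need only range over the names `σ i`. This is not automatic: a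
bound variable is encoded by an arbitrary function on names. -/
def Extensional (Φ : TopName.{u} T → SetFormula (TopName.{u} T)) : Prop :=
  ∀ ⦃σ τ : TopName.{u} T⦄ ⦃x : T⦄, x ∈ eqVal σ τ → x ∈ (Φ σ).value → x ∈ (Φ τ).value

theorem extensional_const (φ : SetFormula (TopName.{u} T)) : Extensional fun _ => φ :=
  fun _ _ _ _ h => h

theorem extensional_eq_left (τ : TopName.{u} T) : Extensional fun σ => eq σ τ :=
  fun _ _ _ hx h => mem_eqVal_trans (mem_eqVal_symm hx) h

theorem extensional_eq_right (τ : TopName.{u} T) : Extensional fun σ => eq τ σ :=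
  fun _ _ _ hx h => mem_eqVal_trans h hx

theorem extensional_mem_left (τ : TopName.{u} T) : Extensional fun σ => mem σ τ := by
  obtain ⟨J, τs, s⟩ := τ
  intro _ _ _ hx h
  obtain ⟨j, hj, hxj⟩ := mem_memVal_mk.1 h
  exact mem_memVal_mk.2 ⟨j, hj, mem_eqVal_trans (mem_eqVal_symm hx) hxj⟩

theorem extensional_mem_right (τ : TopName.{u} T) : Extensional fun σ => mem τ σ := by
  rintro ⟨I, σs, r⟩ ⟨J, τs, s⟩ _ hx h
  obtain ⟨i, hi, hxi⟩ := mem_memVal_mk.1 h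
  obtain ⟨j, hj, hij⟩ := exists_of_mem_eqVal_mk hx hi
  exact mem_memVal_mk.2 ⟨j, hj, mem_eqVal_trans hxi hij⟩

namespace Extensional

theorem and (hΦ : Extensional Φ) (hΨ : Extensional Ψ) :
    Extensional fun σ => SetFormula.and (Φ σ) (Ψ σ) :=
  fun _ _ _ hx h => ⟨hΦ hx h.1, hΨ hx h.2⟩

theorem or (hΦ : Extensional Φ) (hΨ : Extensional Ψ) :
    Extensional fun σ => SetFormula.or (Φ σ) (Ψ σ) :=
  fun _ _ _ hx h => h.imp (hΦ hx ·) (hΨ hx ·)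

theorem imp (hΦ : Extensional Φ) (hΨ : Extensional Ψ) :
    Extensional fun σ => SetFormula.imp (Φ σ) (Ψ σ) := by
  intro σ τ x hx h
  have hforces : Forces (eqVal σ τ ⊓ (SetFormula.imp (Φ σ) (Ψ σ)).value)
      (SetFormula.imp (Φ τ) (Ψ τ)) :=
    forces_imp.2 fun y hy hφ => hΨ hy.1 (mem_value_imp hy.2 (hΦ (mem_eqVal_symm hy.1) hφ))
  exact hforces ⟨hx, h⟩

variable {Θ : TopName.{u} T → TopName.{u} T → SetFormula (TopName.{u} T)}

theorem all (hΘ : ∀ ρ, Extensional (Θ ρ)) : Extensional fun σ => SetFormula.all (Θ · σ) := by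
  intro σ τ x hx h
  have hforces : Forces (eqVal σ τ ⊓ (SetFormula.all (Θ · σ)).value) (SetFormula.all (Θ · τ)) :=
    forces_all.2 fun ρ y hy => hΘ ρ hy.1 (mem_value_all hy.2 ρ)
  exact hforces ⟨hx, h⟩

theorem ex (hΘ : ∀ ρ, Extensional (Θ ρ)) : Extensional fun σ => SetFormula.ex (Θ · σ) :=
  fun _ _ _ hx h => mem_value_ex.2 ((mem_value_ex.1 h).imp fun ρ hρ => hΘ ρ hx hρ)

theorem ballIn (A : TopName.{u} T) (hΘ : ∀ ρ, Extensional (Θ ρ)) :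
    Extensional fun σ => SetFormula.ballIn A (Θ · σ) :=
  .all fun ρ => .imp (extensional_const _) (hΘ ρ)

theorem bexIn (A : TopName.{u} T) (hΘ : ∀ ρ, Extensional (Θ ρ)) :
    Extensional fun σ => SetFormula.bexIn A (Θ · σ) :=
  .ex fun ρ => .and (extensional_const _) (hΘ ρ)

variable {s t : TopName.{u} T → TopName.{u} T}

theorem isPair (z : TopName.{u} T) (hs : ∀ ρ, Extensional fun σ => eq ρ (s σ))
    (ht : ∀ ρ, Extensional fun σ => eq ρ (t σ)) :
    Extensional fun σ => SetFormula.isPair z (s σ) (t σ) :=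
  .all fun ρ => .and (.imp (extensional_const _) (.or (hs ρ) (ht ρ)))
    (.imp (.or (hs ρ) (ht ρ)) (extensional_const _))

theorem pairMem (f : TopName.{u} T) (hs : ∀ ρ, Extensional fun σ => eq ρ (s σ))
    (ht : ∀ ρ, Extensional fun σ => eq ρ (t σ)) :
    Extensional fun σ => SetFormula.pairMem f (s σ) (t σ) :=
  .bexIn f fun _ => .ex fun _ => .ex fun _ =>
    .and (.isPair _ hs hs) (.and (.isPair _ hs ht) (extensional_const _))

end Extensional

theorem extensional_pairMem_left (f τ : TopName.{u} T) : Extensional fun σ => pairMem f σ τ :=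
  .pairMem f extensional_eq_right fun _ => extensional_const _

theorem extensional_pairMem_right (f τ : TopName.{u} T) : Extensional fun σ => pairMem f τ σ :=
  .pairMem f (fun _ => extensional_const _) extensional_eq_right

theorem extensional_isValue (f τ : TopName.{u} T) : Extensional fun σ => isValue f τ σ :=
  .and (extensional_pairMem_right f τ)
    (.all fun ρ => .imp (extensional_const _) (extensional_eq_right ρ))

theorem forces_ballIn_mk (hΦ : Extensional Φ) :
    Forces p (ballIn (mk I σs r) Φ) ↔ ∀ i, ∀ x ∈ p, x ∈ r i → x ∈ (Φ (σs i)).value := by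
  refine forces_ballIn.trans ⟨fun h i x hx hi => ?_, fun h σ x hx hσ => ?_⟩
  · exact h (σs i) x hx (mem_memVal_mk.2 ⟨i, hi, mem_eqVal_refl _ x⟩)
  · obtain ⟨i, hi, hxi⟩ := mem_memVal_mk.1 hσ
    exact hΦ (mem_eqVal_symm hxi) (h i x hx hi)

theorem mem_value_bexIn_mk (hΦ : Extensional Φ) :
    x ∈ (bexIn (mk I σs r) Φ).value ↔ ∃ i, x ∈ r i ∧ x ∈ (Φ (σs i)).value := by
  refine mem_value_ex.trans ⟨fun ⟨σ, hσ, h⟩ => ?_, fun ⟨i, hi, h⟩ => ?_⟩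
  · obtain ⟨i, hi, hxi⟩ := mem_memVal_mk.1 hσ
    exact ⟨i, hi, hΦ hxi h⟩
  · exact ⟨σs i, mem_memVal_mk.2 ⟨i, hi, mem_eqVal_refl _ x⟩, h⟩

theorem mem_eqVal_of_mem_value_isValue {ρ : TopName.{u} T} (hτ : x ∈ (isValue f σ τ).value)
    (hρ : x ∈ (pairMem f σ ρ).value) : x ∈ eqVal ρ τ :=
  mem_value_imp (mem_value_all hτ.2 ρ) hρ

/-- On a connected set, the values taken by `f` at `σ` split the set into disjoint open pieces,
because equality of canonical names does not depend on the point of the space. -/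
theorem exists_forces_isValue_hat {c : I → PSet.{u}} (hp : IsPreconnected (p : Set T))
    (hne : (p : Set T).Nonempty) (hf : Forces p (isFun f A (mk I (fun i => hat (c i)) r)))
    (hσ : Forces p (mem σ A)) :
    ∃ i, Forces p (and (mem (hat (c i)) (mk I (fun i => hat (c i)) r))
      (isValue f σ (hat (c i)))) := by
  set B : TopName.{u} T := mk I (fun i => hat (c i)) r
  let W (i : I) : Opens T := (and (mem (hat (c i)) B) (isValue f σ (hat (c i)))).value
  have hcover : ∀ x ∈ p, ∃ i, x ∈ W i := fun x hx => by
    obtain ⟨i, hi, hv⟩ := (mem_value_bexIn_mk (extensional_isValue f σ)).1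
      (mem_value_ballIn (hf hx).2 (hσ hx))
    exact ⟨i, mem_memVal_mk.2 ⟨i, hi, mem_eqVal_refl _ x⟩, hv⟩
  have hequiv : ∀ {i j x}, x ∈ W i → x ∈ W j → PSet.Equiv (c i) (c j) := fun hi hj =>
    mem_eqVal_hat_hat.1 (mem_eqVal_of_mem_value_isValue hj.2 hi.2.1)
  have htransport : ∀ {i j x}, PSet.Equiv (c j) (c i) → x ∈ W j → x ∈ W i := fun h hj =>
    ((extensional_mem_left B).and (extensional_isValue f σ)) (mem_eqVal_hat_hat.2 h) hj
  obtain ⟨x, hx⟩ := hne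
  obtain ⟨i, hi⟩ := hcover x hx
  let V : Opens T := ⨆ j : {j // ¬ PSet.Equiv (c j) (c i)}, W j
  have hdisj : Disjoint (W i : Set T) V := Set.disjoint_left.2 fun y hyi hyV => by
    obtain ⟨j, hyj⟩ := Opens.mem_iSup.1 hyV
    exact j.2 (hequiv hyj hyi)
  refine ⟨i, hp.subset_left_of_subset_union (W i).isOpen V.isOpen hdisj (fun y hy => ?_)
    ⟨x, hx, hi⟩⟩
  obtain ⟨j, hj⟩ := hcover y hy
  by_cases h : PSet.Equiv (c j) (c i)
  · exact Or.inl (htransport h hj)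
  · exact Or.inr (Opens.mem_iSup.2 ⟨⟨j, h⟩, hj⟩)

end SetFormula

namespace UnbddSet

open TopName SetFormula

variable {P : Finset ℕ} {N : Set ℕ} {X : UnbddSet} {m n : ℕ} {p : Opens UnbddSet}
  {Φ : TopName.{u} UnbddSet → SetFormula (TopName.{u} UnbddSet)}

/-- The union of a point `X` of the space with a set of natural numbers, which need not be unbounded
itself: `Y` is a second point when basic open sets are shown to be connected, and a finite set when
`X ∪ Y` is to stay in a neighbourhood of `X`. -/
def union (X : UnbddSet) (Y : Set ℕ) : UnbddSet :=
  ⟨X.1 ∪ Y, fun h => X.2 (h.mono Set.subset_union_left)⟩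

theorem union_mem_basicSet {Y : Set ℕ} (hP : ↑P ⊆ X.1 ∪ Y) (hX : (N ∩ X.1).Finite)
    (hY : (N ∩ Y).Finite) : X.union Y ∈ basicSet P N :=
  ⟨hP, (Set.inter_union_distrib_left N X.1 Y).symm ▸ hX.union hY⟩

/-- A neighbourhood of `X ∪ Y` prescribes only a finite set `Q` of elements, and `X ∪ Q` lies in
every neighbourhood of `X`. -/
theorem union_mem_closure {U : Set UnbddSet} (hU : IsOpen U) (hX : X ∈ U) (Y : Set ℕ) :
    X.union Y ∈ closure U := by
  rw [isTopologicalBasis_basicSet.mem_closure_iff]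
  rintro _ ⟨Q, K, rfl⟩ ⟨-, hK⟩
  obtain ⟨_, ⟨P, N, rfl⟩, ⟨hP, hN⟩, hPNU⟩ :=
    isTopologicalBasis_basicSet.exists_subset_of_mem_open hX hU
  have hQ (L : Set ℕ) : (L ∩ Q).Finite := Q.finite_toSet.inter_of_right L
  have hKX : (K ∩ X.1).Finite := hK.subset (Set.inter_subset_inter_right K Set.subset_union_left)
  exact ⟨X.union Q, union_mem_basicSet Set.subset_union_right hKX (hQ K),
    hPNU (union_mem_basicSet (hP.trans Set.subset_union_left) hN (hQ N))⟩

theorem isPreconnected_basicSet (P : Finset ℕ) (N : Set ℕ) : IsPreconnected (basicSet P N) := by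
  rintro U V hU hV hUV ⟨X, hX, hXU⟩ ⟨Y, hY, hYV⟩
  have hopen : IsOpen (basicSet P N) := (basicOpen P N).isOpen
  have hXY : X.union Y.1 ∈ basicSet P N :=
    union_mem_basicSet (hX.1.trans Set.subset_union_left) hX.2 hY.2
  rcases hUV hXY with hmem | hmem
  · have hcl : X.union Y.1 ∈ closure (basicSet P N ∩ V) := by
      have hcomm : X.union Y.1 = Y.union X.1 := Subtype.ext (Set.union_comm X.1 Y.1)
      exact hcomm ▸ union_mem_closure (hopen.inter hV) ⟨hY, hYV⟩ X.1
    obtain ⟨Z, hZU, hZ, hZV⟩ := mem_closure_iff.1 hcl U hU hmem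
    exact ⟨Z, hZ, hZU, hZV⟩
  · have hcl : X.union Y.1 ∈ closure (basicSet P N ∩ U) :=
      union_mem_closure (hopen.inter hU) ⟨hX, hXU⟩ Y.1
    obtain ⟨Z, hZV, hZ, hZU⟩ := mem_closure_iff.1 hcl V hV hmem
    exact ⟨Z, hZ, hZU, hZV⟩

theorem exists_notMem_of_notMem (hne : (basicSet P N).Nonempty) (hn : n ∉ P) :
    ∃ X ∈ basicSet P N, n ∉ X.1 := by
  obtain ⟨X, hP, hN⟩ := hne
  have hunbdd : ¬ BddAbove (X.1 \ {n}) := fun hb => X.2 <|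
    (hb.union bddAbove_singleton).mono (Set.sdiff_union_self.symm ▸ Set.subset_union_left)
  exact ⟨⟨X.1 \ {n}, hunbdd⟩, ⟨Set.subset_sdiff_singleton hP hn,
    hN.subset (Set.inter_subset_inter_right N Set.sdiff_subset)⟩, fun h => h.2 rfl⟩

theorem mem_basicOpen_singleton : X ∈ basicOpen {n} ∅ ↔ n ∈ X.1 := by
  change X ∈ basicSet {n} ∅ ↔ n ∈ X.1
  simp [basicSet]

theorem mem_memVal_natName_natName : X ∈ memVal (natName.{u} m) (natName n) ↔ m < n :=
  mem_memVal_hat_hat.trans pset_ofNat_mem_ofNat_iff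

theorem mem_value_le_natName : X ∈ (le (natName.{u} m) (natName n)).value ↔ m ≤ n :=
  (or_congr mem_memVal_natName_natName
    (mem_eqVal_hat_hat.trans pset_ofNat_equiv_ofNat_iff)).trans le_iff_lt_or_eq.symm

theorem mem_memVal_natName_omegaName (X : UnbddSet) (n : ℕ) :
    X ∈ memVal (natName.{u} n) omegaName :=
  mem_memVal_hat_hat.2 (PSet.func_mem PSet.omega ⟨n⟩)

theorem mem_memVal_natName_genericName : X ∈ memVal (natName.{u} n) genericName ↔ n ∈ X.1 := by
  simp only [genericName, mem_memVal_mk, ULift.exists, mem_basicOpen_singleton, natName,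
    mem_eqVal_hat_hat, pset_ofNat_equiv_ofNat_iff, exists_eq_right']

theorem forces_ballIn_omegaName (hΦ : Extensional Φ) :
    Forces p (ballIn omegaName Φ) ↔ ∀ n, Forces p (Φ (natName n)) :=
  (forces_ballIn_mk hΦ).trans
    ⟨fun h n _ hX => h ⟨n⟩ _ hX trivial, fun h n _ hX _ => h n.down hX⟩

theorem mem_value_bexIn_omegaName (hΦ : Extensional Φ) :
    X ∈ (bexIn omegaName Φ).value ↔ ∃ n, X ∈ (Φ (natName n)).value :=
  (mem_value_bexIn_mk hΦ).trans
    ⟨fun ⟨n, _, h⟩ => ⟨n.down, h⟩, fun ⟨n, h⟩ => ⟨⟨n⟩, trivial, h⟩⟩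

theorem forces_natName_mem_genericName_iff (hne : (basicSet P N).Nonempty) :
    Forces (basicOpen P N) (mem (natName.{u} n) genericName) ↔ n ∈ P := by
  refine ⟨fun h => ?_, fun hn X hX => mem_memVal_natName_genericName.2 (hX.1 hn)⟩
  by_contra hn
  obtain ⟨X, hX, hnX⟩ := exists_notMem_of_notMem hne hn
  exact hnX (mem_memVal_natName_genericName.1 (h hX))

theorem forces_genericName_sub_omegaName : Forces ⊤ (sub genericName.{u} omegaName) :=
  (forces_ballIn_mk (extensional_mem_left _)).2 fun n X _ _ =>
    mem_memVal_natName_omegaName X n.down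

theorem forces_unbounded_genericName : Forces ⊤ (unbounded omegaName.{u} genericName) := by
  refine (forces_ballIn_omegaName (.bexIn _ extensional_mem_left)).2 fun n X _ => ?_
  obtain ⟨m, hm, hnm⟩ := not_bddAbove_iff.1 X.2 n
  exact mem_value_ex.2 ⟨natName m, mem_memVal_natName_genericName.2 hm,
    mem_memVal_natName_natName.2 hnm⟩

theorem notMem_value_bounded_genericName (X : UnbddSet) :
    X ∉ (bounded omegaName.{u} genericName).value := by
  have hext : Extensional fun N : TopName.{u} UnbddSet => ballIn genericName (le · N) :=
    .ballIn _ fun i => .or (extensional_mem_right i) (extensional_eq_right i)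
  intro h
  obtain ⟨n, hn⟩ := (mem_value_bexIn_omegaName hext).1 h
  have hle (m : ℕ) (hm : m ∈ X.1) : X ∈ (le (natName.{u} m) (natName n)).value :=
    mem_value_ballIn (Φ := (le · (natName n))) hn (mem_memVal_natName_genericName.2 hm)
  exact X.2 ⟨n, fun m hm => mem_value_le_natName.1 (hle m hm)⟩

theorem exists_mem_forces_isValue_natName {a : TopName.{u} UnbddSet}
    (hne : (basicSet P N).Nonempty)
    (ha : Forces (basicOpen P N) (isFun a omegaName genericName)) (n : ℕ) :
    ∃ m ∈ P, Forces (basicOpen P N) (isValue a (natName n) (natName m)) := by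
  obtain ⟨⟨m⟩, hm⟩ := exists_forces_isValue_hat (isPreconnected_basicSet P N) hne ha
    fun X _ => mem_memVal_natName_omegaName X n
  exact ⟨m, (forces_natName_mem_genericName_iff hne).1 fun _ hX => (hm hX).1,
    fun _ hX => (hm hX).2⟩

theorem forces_sequentiallyBounded_genericName :
    Forces ⊤ (sequentiallyBounded omegaName.{u} genericName) := by
  refine forces_all.2 fun a => forces_imp.2 fun X _ hX => ?_
  obtain ⟨_, ⟨P, N, rfl⟩, hXPN, ha⟩ :=
    isTopologicalBasis_basicSet.exists_subset_of_mem_open hX (Opens.isOpen _)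
  have hext (M : TopName.{u} UnbddSet) :
      Extensional fun n => all fun y => imp (pairMem a n y) (le y M) :=
    .all fun y => .imp (extensional_pairMem_left a y) (extensional_const _)
  suffices hbound : Forces (basicOpen P N) (ballIn omegaName fun n => all fun y =>
      imp (pairMem a n y) (le y (natName (P.sup id)))) from
    mem_value_ex.2 ⟨natName (P.sup id), mem_memVal_natName_omegaName X _, hbound hXPN⟩
  refine (forces_ballIn_omegaName (hext _)).2 fun n => forces_all.2 fun y =>
    forces_imp.2 fun Y hY hpair => ?_
  obtain ⟨m, hm, hval⟩ := exists_mem_forces_isValue_natName ⟨X, hXPN⟩ ha n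
  have hle : Y ∈ (le (natName.{u} m) (natName (P.sup id))).value :=
    mem_value_le_natName.2 (Finset.le_sup (f := id) hm)
  exact Extensional.or (extensional_mem_left _) (extensional_eq_left _)
    (mem_eqVal_symm (mem_eqVal_of_mem_value_isValue (hval hY) hpair)) hle

theorem forces_neg_weakBD : Forces ⊤ (neg (weakBD omegaName.{u})) :=
  forces_imp.2 fun X hX hBD => notMem_value_bounded_genericName X <|
    mem_value_imp (mem_value_all hBD genericName)
      ⟨forces_genericName_sub_omegaName hX, forces_sequentiallyBounded_genericName hX⟩

end UnbddSet

theorem mainTheorem3 :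
    -- the canonical generic: a nonempty basic open set forces `n ∈ G` iff `n` belongs to its
    -- positive part
    (∀ (P : Finset ℕ) (N : Set ℕ) (n : ℕ), (UnbddSet.basicSet P N).Nonempty →
      (Forces (UnbddSet.basicOpen P N)
        (SetFormula.mem (UnbddSet.natName.{u} n) UnbddSet.genericName.{u}) ↔ n ∈ P)) ∧
    -- `T ⊩ G ⊆ ω`
    Forces ⊤ (SetFormula.sub UnbddSet.genericName.{u} UnbddSet.omegaName.{u}) ∧
    -- `T ⊩ G is unbounded`
    Forces ⊤ (SetFormula.unbounded UnbddSet.omegaName.{u} UnbddSet.genericName.{u}) ∧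
    -- `T ⊩ G is sequentially bounded`
    Forces ⊤ (SetFormula.sequentiallyBounded UnbddSet.omegaName.{u} UnbddSet.genericName.{u}) ∧
    -- `T ⊩` not every sequentially bounded set of natural numbers is bounded
    Forces ⊤ (SetFormula.neg (SetFormula.weakBD UnbddSet.omegaName.{u})) := by
  exact ⟨fun _ _ _ hne => UnbddSet.forces_natName_mem_genericName_iff hne,
    UnbddSet.forces_genericName_sub_omegaName, UnbddSet.forces_unbounded_genericName,
    UnbddSet.forces_sequentiallyBounded_genericName, UnbddSet.forces_neg_weakBD⟩
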